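/- Let $P$ be a probabilistic program over finite sets $X$ of real-valued program variables and $R$ of sampling variables, built by sequential composition from $\mathbf{skip}$, simultaneous assignments $x_{n_1},\dots,x_{n_k}:=E_1,\dots,E_k$ with polynomials $E_j$ over $X\cup R$, while-loops guarded by propositional polynomial predicates over $X$ (Boolean combinations of polynomial inequalities), and if-statements whose guard is such a predicate, a probabilistic choice $\mathbf{prob}(p)$ with $p\in(0,1)$, or a demonic choice $\star$. Each sampling variable $r$ has a probability distribution on $\mathbb{R}$ and a non-empty bounded interval $\mathrm{Supp}_r$ that contains its value with probability $1$. Let $L$ be the finite set of labels of the control flow graph of $P$ (one label per assignment, skip, if- and while-statement), partitioned into assignment, probabilistic, branching and demonic labels; let $\bot\notin L$ be the terminal label, $L_\bot=L\cup\{\bot\}$, $\ell_0$ the label of the first statement and $x_0\in\mathbb{R}^X$ the initial valuation. An assignment label $\ell$ has a single transition $(\ell,f,\ell')$ with update function $f\colon\mathbb{R}^X\times\mathbb{R}^R\to\mathbb{R}^X$; a probabilistic label has transitions $(\ell,p,\ell_1),(\ell,1-p,\ell_2)$; a branching label $(\ell,\phi,\ell_1),(\ell,\neg\phi,\ell_2)$;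 a demonic label $(\ell,\star,\ell_1),(\ell,\star,\ell_2)$. A configuration is a pair $(\ell,x)\in L_\bot\times\mathbb{R}^X$. A (measurable) scheduler $\sigma$ assigns to each finite path that starts in $(\ell_0,x_0)$ and ends in a demonic label one of the transitions of that label. Under $\sigma$ the program starts in $(\ell_0,x_0)$ and moves step by step: an assignment label draws fresh independent samples $r$ of all sampling variables and moves to $(\ell',f(x,r))$, the other labels keep $x$ and move along the transition chosen at random with the given probabilities, by the predicate that holds at $x$, or by $\sigma$; $\bot$ is absorbing. This induces a probability measure $\mathbb{P}^\sigma$ on runs with expectation $\mathbb{E}^\sigma$. Let $T_P\in\mathbb{N}_0\cup\{\infty\}$ be the first time at which the label is $\bot$, and $\mathsf{ET}(P)=\sup_\sigma\mathbb{E}^\sigma(T_P)$. Let $I$ be a polynomial invariant, i.e. a map assigning to each label a propositional polynomial predicate over $X$ such that $x\models I(\ell)$ for every configuration $(\ell,x)$ reachable from $(\ell_0,x_0)$ by a finite path with sampled values in the intervals $\mathrm{Supp}_r$. For $\eta\colon L_\bot\times\mathbb{R}^X\to\mathbb{R}$ define $\mathrm{pre}_\eta(\ell,x)$ as $\mathbb{E}_r\,\eta(\ell',f(x,r))$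 (independent samples $r$), $p\,\eta(\ell_1,x)+(1-p)\,\eta(\ell_2,x)$, $\eta(\ell_1,x)$ if $x\models\phi$ and $\eta(\ell_2,x)$ otherwise, and $\max\{\eta(\ell_1,x),\eta(\ell_2,x)\}$ at an assignment, probabilistic, branching and demonic label, respectively. Suppose that $\eta$ is a $d$-degree polynomial ranking supermartingale for $(P,I)$ with constants $\epsilon>0$ and $K\le-\epsilon$, that is, for all $x\in\mathbb{R}^X$: (C1) for each $\ell\in L_\bot$, $\eta(\ell,\cdot)$ is a polynomial of total degree at most $d$; (C2) if $\ell\in L$ and $x\models I(\ell)$, then $\eta(\ell,x)\ge0$; (C3) $\eta(\bot,x)=K$; (C4) if $\ell\in L$ and $x\models I(\ell)$, and, in case $\ell$ is a branching label, the predicate of some transition of $\ell$ with target different from $\bot$ holds at $x$, then $\mathrm{pre}_\eta(\ell,x)\le\eta(\ell,x)-\epsilon$. Then $P$ terminates almost surely under every scheduler, i.e. $\mathbb{P}^\sigma(T_P<\infty)=1$ for all $\sigma$, and $$\mathsf{ET}(P)\le\frac{\eta(\ell_0,x_0)-K}{\epsilon}.$$ -/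

import Mathlib

noncomputable section

namespace PP

open MeasureTheory ProbabilityTheory

/-! ### Propositional polynomial predicates -/

/-- Propositional polynomial predicates over the variables `X`. -/
inductive Pred (X : Type*) where
  | tru : Pred X
  | fls : Pred X
  | lt (g₁ g₂ : MvPolynomial X ℝ) : Pred X
  | le (g₁ g₂ : MvPolynomial X ℝ) : Pred X
  | gt (g₁ g₂ : MvPolynomial X ℝ) : Pred X
  | ge (g₁ g₂ : MvPolynomial X ℝ) : Pred X
  | not (φ : Pred X) : Pred X
  | and (φ ψ : Pred X) : Pred X
  | or (φ ψ : Pred X) : Pred X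

/-- The satisfaction relation `x ⊨ φ`. -/
def Pred.Sat {X : Type*} (x : X → ℝ) : Pred X → Prop
  | .tru => True
  | .fls => False
  | .lt g₁ g₂ => MvPolynomial.eval x g₁ < MvPolynomial.eval x g₂
  | .le g₁ g₂ => MvPolynomial.eval x g₁ ≤ MvPolynomial.eval x g₂
  | .gt g₁ g₂ => MvPolynomial.eval x g₁ > MvPolynomial.eval x g₂
  | .ge g₁ g₂ => MvPolynomial.eval x g₁ ≥ MvPolynomial.eval x g₂
  | .not φ => ¬ φ.Sat x
  | .and φ ψ => φ.Sat x ∧ ψ.Sat x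
  | .or φ ψ => φ.Sat x ∨ ψ.Sat x

/-! ### Sampling variables -/

/-- Bounded sampling variables: each `r : R` has a probability distribution on `ℝ` (equivalently,
a cumulative distribution function) and a non-empty bounded interval that contains the sampled
values with probability one. -/
structure Sampling (R : Type*) where
  law : R → Measure ℝ
  isProb : ∀ r, IsProbabilityMeasure (law r)
  supp : R → Set ℝ
  supp_nonempty : ∀ r, (supp r).Nonempty
  supp_interval : ∀ r, (supp r).OrdConnected
  supp_bounded : ∀ r, Bornology.IsBounded (supp r)
  ae_mem_supp : ∀ r, ∀ᵐ z ∂(law r), z ∈ supp r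

instance Sampling.instIsProb {R : Type*} (S : Sampling R) (r : R) :
    IsProbabilityMeasure (S.law r) := S.isProb r

/-- The joint law of one (independent) sample of all sampling variables. -/
def Sampling.joint {R : Type*} [Fintype R] (S : Sampling R) : Measure (R → ℝ) :=
  Measure.pi S.law

instance Sampling.instIsProbJoint {R : Type*} [Fintype R] (S : Sampling R) :
    IsProbabilityMeasure S.joint := by
  unfold Sampling.joint; infer_instance

/-! ### Control flow graphs -/

/-- A polynomial update function `ℝ^X × ℝ^R → ℝ^X`. -/
abbrev Update (X R : Type*) := X → MvPolynomial (X ⊕ R) ℝ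

/-- The value `f(x, r)` of an update function. -/
def Update.apply {X R : Type*} (f : Update X R) (x : X → ℝ) (r : R → ℝ) : X → ℝ :=
  fun i => MvPolynomial.eval (Sum.elim x r) (f i)

/-- Labels including the terminal label: `none` is the terminal label `⊥`, which is not in `L`. -/
abbrev LabelBot (L : Type*) := Option L

instance LabelBot.instMeasurableSpace {L : Type*} : MeasurableSpace (LabelBot L) := ⊤

instance LabelBot.instDiscrete {L : Type*} : DiscreteMeasurableSpace (LabelBot L) :=
  ⟨fun _ => trivial⟩

/-- The kind of a label (assignment, probabilistic, branching, demonic) together with its outgoing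
transitions:
* `assign f ℓ'`: the only transition is `(ℓ, f, ℓ')`;
* `prob p ℓ₁ ℓ₂`: the transitions are `(ℓ, p, ℓ₁)` and `(ℓ, 1 - p, ℓ₂)`;
* `branch φ ℓ₁ ℓ₂`: the transitions are `(ℓ, φ, ℓ₁)` and `(ℓ, ¬φ, ℓ₂)`;
* `demonic ℓ₁ ℓ₂`: the transitions are `(ℓ, ⋆, ℓ₁)` and `(ℓ, ⋆, ℓ₂)`. -/
inductive Node (L X R : Type*) where
  | assign (f : Update X R) (l' : LabelBot L) : Node L X R
  | prob (p : Set.Ioo (0 : ℝ) 1) (l₁ l₂ : LabelBot L) : Node L X R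
  | branch (φ : Pred X) (l₁ l₂ : LabelBot L) : Node L X R
  | demonic (l₁ l₂ : LabelBot L) : Node L X R

/-- Renaming the target labels of the transitions. -/
def Node.map {L L' X R : Type*} (g : LabelBot L → LabelBot L') : Node L X R → Node L' X R
  | .assign f l' => .assign f (g l')
  | .prob p l₁ l₂ => .prob p (g l₁) (g l₂)
  | .branch φ l₁ l₂ => .branch φ (g l₁) (g l₂)
  | .demonic l₁ l₂ => .demonic (g l₁) (g l₂)

/-- A control flow graph with label set `L`, program variables `X`, sampling variables `R`. -/
structure CFG (L X R : Type*) where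
  node : L → Node L X R

/-! ### Program syntax and its control flow graph -/

/-- Guards of if-statements: `⋆`, `prob(p)` with `p ∈ (0,1)`, or a polynomial predicate. -/
inductive Guard (X : Type*) where
  | star : Guard X
  | prob (p : Set.Ioo (0 : ℝ) 1) : Guard X
  | pred (φ : Pred X) : Guard X

/-- Probabilistic programs. In `assign E`, the variables `x` with `E x = some e` are simultaneously
assigned the values of the polynomial expressions `e`; the other variables are left unchanged;
`loop φ P` is `while φ do P od`. -/
inductive Program (X R : Type*) where
  | skip : Program X R
  | assign (E : X → Option (MvPolynomial (X ⊕ R) ℝ)) : Program X R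
  | seq (P Q : Program X R) : Program X R
  | ite (B : Guard X) (P Q : Program X R) : Program X R
  | loop (φ : Pred X) (P : Program X R) : Program X R

namespace Program

variable {X R : Type*}

/-- The (non-terminal) labels of a program: one for each atomic statement, if-statement and
while-statement. -/
def Label : Program X R → Type
  | skip => Unit
  | assign _ => Unit
  | seq P Q => P.Label ⊕ Q.Label
  | ite _ P Q => Unit ⊕ (P.Label ⊕ Q.Label)
  | loop _ P => Unit ⊕ P.Label

instance instFiniteLabel : (P : Program X R) → Finite P.Label
  | skip => inferInstanceAs (Finite Unit)
  | assign _ => inferInstanceAs (Finite Unit)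
  | seq P Q =>
    have := instFiniteLabel P
    have := instFiniteLabel Q
    inferInstanceAs (Finite (P.Label ⊕ Q.Label))
  | ite _ P Q =>
    have := instFiniteLabel P
    have := instFiniteLabel Q
    inferInstanceAs (Finite (Unit ⊕ (P.Label ⊕ Q.Label)))
  | loop _ P =>
    have := instFiniteLabel P
    inferInstanceAs (Finite (Unit ⊕ P.Label))

/-- The label of the first statement to be executed. -/
def entry : (P : Program X R) → P.Label
  | skip => ()
  | assign _ => ()
  | seq P _ => Sum.inl P.entry
  | ite _ _ _ => Sum.inl ()
  | loop _ _ => Sum.inl ()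

/-- The transitions of each label. In `P; Q` the terminal label of `P` is identified with the entry
of `Q`; in `while φ do P od` the terminal label of `P` is identified with the loop head. -/
def node : (P : Program X R) → P.Label → Node P.Label X R
  | skip, _ => .assign (fun i => MvPolynomial.X (Sum.inl i)) none
  | assign E, _ => .assign (fun i => (E i).getD (MvPolynomial.X (Sum.inl i))) none
  | seq P Q, Sum.inl l =>
    (P.node l).map fun
      | none => some (Sum.inr Q.entry)
      | some l' => some (Sum.inl l')
  | seq _ Q, Sum.inr l => (Q.node l).map (Option.map Sum.inr)
  | ite B P Q, Sum.inl () =>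
    match B with
    | .star => .demonic (some (Sum.inr (Sum.inl P.entry))) (some (Sum.inr (Sum.inr Q.entry)))
    | .prob p => .prob p (some (Sum.inr (Sum.inl P.entry))) (some (Sum.inr (Sum.inr Q.entry)))
    | .pred φ => .branch φ (some (Sum.inr (Sum.inl P.entry))) (some (Sum.inr (Sum.inr Q.entry)))
  | ite _ P _, Sum.inr (Sum.inl l) => (P.node l).map (Option.map fun l' => Sum.inr (Sum.inl l'))
  | ite _ _ Q, Sum.inr (Sum.inr l) => (Q.node l).map (Option.map fun l' => Sum.inr (Sum.inr l'))
  | loop φ P, Sum.inl () => .branch φ (some (Sum.inr P.entry)) none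
  | loop _ P, Sum.inr l =>
    (P.node l).map fun
      | none => some (Sum.inl ())
      | some l' => some (Sum.inr l')

/-- The control flow graph of a program. -/
def cfg (P : Program X R) : CFG P.Label X R := ⟨P.node⟩

end Program

/-! ### Configurations, reachability, invariants -/

/-- Configurations `(ℓ, x)` with `ℓ ∈ L ∪ {⊥}`. -/
abbrev Config (L X : Type*) := LabelBot L × (X → ℝ)

/-- `G.Step S c c'`: the configuration `c'` may directly follow `c` on a path. -/
def CFG.Step {L X R : Type*} (G : CFG L X R) (S : Sampling R) : Config L X → Config L X → Prop
  | (none, x), c' => c' = (none, x)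
  | (some l, x), c' =>
    match G.node l with
    | .assign f l' => ∃ r : R → ℝ, (∀ i, r i ∈ S.supp i) ∧ c' = (l', f.apply x r)
    | .prob _ l₁ l₂ => c' = (l₁, x) ∨ c' = (l₂, x)
    | .branch φ l₁ l₂ => (φ.Sat x ∧ c' = (l₁, x)) ∨ (¬ φ.Sat x ∧ c' = (l₂, x))
    | .demonic l₁ l₂ => c' = (l₁, x) ∨ c' = (l₂, x)

/-- `c` is reachable from `c₀`, i.e. some finite path leads from `c₀` to `c`. -/
def CFG.Reachable {L X R : Type*} (G : CFG L X R) (S : Sampling R) (c₀ c : Config L X) : Prop :=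
  Relation.ReflTransGen (G.Step S) c₀ c

/-- `I` is a polynomial invariant with respect to the initial configuration `c₀`. -/
def CFG.IsInvariant {L X R : Type*} (G : CFG L X R) (S : Sampling R) (c₀ : Config L X)
    (I : LabelBot L → Pred X) : Prop :=
  ∀ l x, G.Reachable S c₀ (l, x) → (I l).Sat x

/-! ### Schedulers and the induced probability measure on runs -/

/-- A scheduler: to every history `c₀, …, cₙ` ending in a demonic label it assigns one of the two
transitions of that label (`true` for the first, `false` for the second); its values at other
histories are irrelevant. Measurability is needed for the induced measure on runs to exist. -/
structure Scheduler (L X : Type*) where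
  choice : (n : ℕ) → (Finset.Iic n → Config L X) → Bool
  measurable_choice : ∀ n, Measurable (choice n)

open Classical in
/-- The law of the next configuration, given the current configuration and the choice `b` of the
scheduler (which matters only at demonic labels). -/
def CFG.stepLaw {L X R : Type*} [Fintype R] (G : CFG L X R) (S : Sampling R) (b : Bool) :
    Config L X → Measure (Config L X)
  | (none, x) => Measure.dirac (none, x)
  | (some l, x) =>
    match G.node l with
    | .assign f l' => S.joint.map fun r => (l', f.apply x r)
    | .prob p l₁ l₂ =>
      ENNReal.ofReal p • Measure.dirac (l₁, x) + ENNReal.ofReal (1 - p) • Measure.dirac (l₂, x)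
    | .branch φ l₁ l₂ => if φ.Sat x then Measure.dirac (l₁, x) else Measure.dirac (l₂, x)
    | .demonic l₁ l₂ => Measure.dirac (if b then l₁ else l₂, x)

theorem Pred.measurableSet_sat {X : Type*} [Finite X] (φ : Pred X) :
    MeasurableSet {x : X → ℝ | φ.Sat x} := by
  have := Fintype.ofFinite X
  have hm : ∀ g : MvPolynomial X ℝ, Measurable fun x : X → ℝ => MvPolynomial.eval x g :=
    fun g => (MvPolynomial.continuous_eval g).measurable
  induction φ with
  | tru => exact MeasurableSet.univ
  | fls => exact MeasurableSet.empty
  | lt g₁ g₂ => exact measurableSet_lt (hm g₁) (hm g₂)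
  | le g₁ g₂ => exact measurableSet_le (hm g₁) (hm g₂)
  | gt g₁ g₂ => exact measurableSet_lt (hm g₂) (hm g₁)
  | ge g₁ g₂ => exact measurableSet_le (hm g₂) (hm g₁)
  | not φ ih => exact ih.compl
  | and φ ψ ih₁ ih₂ => exact ih₁.inter ih₂
  | or φ ψ ih₁ ih₂ => exact ih₁.union ih₂

theorem Update.measurable_apply {X R : Type*} [Finite X] [Finite R] (f : Update X R) :
    Measurable fun p : (X → ℝ) × (R → ℝ) => f.apply p.1 p.2 := by
  have := Fintype.ofFinite X
  have := Fintype.ofFinite R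
  refine measurable_pi_lambda _ fun i => ?_
  refine ((MvPolynomial.continuous_eval (f i)).comp (f := fun p : (X → ℝ) × (R → ℝ) =>
    (Sum.elim p.1 p.2 : X ⊕ R → ℝ)) ?_).measurable
  refine continuous_pi fun j => ?_
  cases j with
  | inl a => exact (continuous_apply a).comp continuous_fst
  | inr a => exact (continuous_apply a).comp continuous_snd

theorem Update.measurable_apply_right {X R : Type*} [Finite X] [Finite R] (f : Update X R)
    (x : X → ℝ) : Measurable fun r : R → ℝ => f.apply x r := by
  have h1 := Update.measurable_apply f
  have h2 : Measurable fun r : R → ℝ => (x, r) := measurable_const.prodMk measurable_id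
  have h3 := h1.comp h2
  simp only [Function.comp_def] at h3
  exact h3

theorem CFG.isProbabilityMeasure_stepLaw {L X R : Type*} [Finite X] [Fintype R]
    (G : CFG L X R) (S : Sampling R) (b : Bool) (c : Config L X) :
    IsProbabilityMeasure (G.stepLaw S b c) := by
  obtain ⟨l, x⟩ := c
  cases l with
  | none => simp only [CFG.stepLaw]; infer_instance
  | some l =>
    simp only [CFG.stepLaw]
    split
    · next f l' _ =>
      exact Measure.isProbabilityMeasure_map
        (measurable_const.prodMk (f.measurable_apply_right x)).aemeasurable
    · next p l₁ l₂ _ =>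
      constructor
      have h0 : (0 : ℝ) ≤ p := p.2.1.le
      have h1 : (0 : ℝ) ≤ 1 - p := by linarith [p.2.2]
      simp [← ENNReal.ofReal_add h0 h1]
    · split <;> infer_instance
    · infer_instance

theorem CFG.measurable_stepLaw {L X R : Type*} [Finite L] [Finite X] [Fintype R]
    (G : CFG L X R) (S : Sampling R) :
    Measurable fun p : Bool × Config L X => G.stepLaw S p.1 p.2 := by
  refine measurable_from_prod_countable_right fun b => ?_
  refine measurable_from_prod_countable_right fun l => ?_
  have hd : ∀ l' : LabelBot L, Measurable fun x : X → ℝ => Measure.dirac ((l', x) : Config L X) :=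
    fun l' => Measure.measurable_dirac.comp measurable_prodMk_left
  cases l with
  | none => exact hd none
  | some l =>
    simp only [CFG.stepLaw]
    split
    · next f l' _ =>
      refine Measure.measurable_of_measurable_coe _ fun s hs => ?_
      have hF : Measurable fun p : (X → ℝ) × (R → ℝ) => ((l', f.apply p.1 p.2) : Config L X) :=
        measurable_const.prodMk f.measurable_apply
      have h1 := measurable_measure_prodMk_left (ν := S.joint) (hF hs)
      have h2 : ∀ x : X → ℝ, (S.joint.map fun r => ((l', f.apply x r) : Config L X)) s =
          S.joint (Prod.mk x ⁻¹' ((fun p : (X → ℝ) × (R → ℝ) =>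
            ((l', f.apply p.1 p.2) : Config L X)) ⁻¹' s)) := fun x =>
        Measure.map_apply (measurable_const.prodMk (f.measurable_apply_right x)) hs
      simpa only [h2] using h1
    · next p l₁ l₂ _ =>
      refine Measure.measurable_of_measurable_coe _ fun s hs => ?_
      have h (l' : LabelBot L) := (Measure.measurable_coe hs).comp (hd l')
      exact ((h l₁).const_mul _).add ((h l₂).const_mul _)
    · next φ l₁ l₂ _ =>
      have hs := Pred.measurableSet_sat φ
      exact Measurable.ite (p := fun x : X → ℝ => φ.Sat x) hs (hd l₁) (hd l₂)
    · next l₁ l₂ _ =>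
      exact hd (if b then l₁ else l₂)

/-- The transition kernel at time `n` under a scheduler: the law of the configuration at time
`n + 1` given the history up to time `n`. -/
def CFG.stepKernel {L X R : Type*} [Finite L] [Finite X] [Fintype R] (G : CFG L X R)
    (S : Sampling R) (σ : Scheduler L X) (n : ℕ) :
    Kernel (Finset.Iic n → Config L X) (Config L X) where
  toFun h := G.stepLaw S (σ.choice n h) (h ⟨n, Finset.mem_Iic.2 le_rfl⟩)
  measurable' := (G.measurable_stepLaw S).comp
    ((σ.measurable_choice n).prodMk (measurable_pi_apply _))

instance CFG.instIsMarkovKernel {L X R : Type*} [Finite L] [Finite X] [Fintype R] (G : CFG L X R)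
    (S : Sampling R) (σ : Scheduler L X) (n : ℕ) : IsMarkovKernel (G.stepKernel S σ n) :=
  ⟨fun _ => G.isProbabilityMeasure_stepLaw S _ _⟩

/-- The probability measure on sequences of configurations induced by the scheduler `σ` and the
initial configuration `c₀`. -/
def CFG.runMeasure {L X R : Type*} [Finite L] [Finite X] [Fintype R] (G : CFG L X R)
    (S : Sampling R) (c₀ : Config L X) (σ : Scheduler L X) : Measure (ℕ → Config L X) :=
  Kernel.traj (X := fun _ => Config L X) (G.stepKernel S σ) 0 (fun _ => c₀)

/-! ### Termination -/

/-- The termination time of a run: the least `n` with `ℓₙ = ⊥`, and `∞` if there is none. -/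
def terminationTime {L X : Type*} (ω : ℕ → Config L X) : ENNReal :=
  ⨅ (n : ℕ) (_ : (ω n).1 = none), (n : ENNReal)

/-- Almost-sure termination under every scheduler. -/
def CFG.ASTerminating {L X R : Type*} [Finite L] [Finite X] [Fintype R] (G : CFG L X R)
    (S : Sampling R) (c₀ : Config L X) : Prop :=
  ∀ σ : Scheduler L X, G.runMeasure S c₀ σ {ω | terminationTime ω < ⊤} = 1

/-- The worst-case expected termination time. -/
def CFG.ET {L X R : Type*} [Finite L] [Finite X] [Fintype R] (G : CFG L X R)
    (S : Sampling R) (c₀ : Config L X) : ENNReal :=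
  ⨆ σ : Scheduler L X, ∫⁻ ω, terminationTime ω ∂(G.runMeasure S c₀ σ)

/-! ### Polynomial ranking supermartingales -/

open Classical in
/-- The pre-expectation of `η`. -/
def CFG.preExp {L X R : Type*} [Fintype R] (G : CFG L X R) (S : Sampling R)
    (η : LabelBot L → (X → ℝ) → ℝ) : LabelBot L → (X → ℝ) → ℝ
  | none, x => η none x
  | some l, x =>
    match G.node l with
    | .assign f l' => ∫ r, η l' (f.apply x r) ∂S.joint
    | .prob p l₁ l₂ => p * η l₁ x + (1 - p) * η l₂ x
    | .branch φ l₁ l₂ => if φ.Sat x then η l₁ x else η l₂ x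
    | .demonic l₁ l₂ => max (η l₁ x) (η l₂ x)

/-- `G.Term l x`: if `l` is a branching label, then some transition of `l` with non-terminal target
is enabled at `x`; no condition at the other labels. -/
def CFG.Term {L X R : Type*} (G : CFG L X R) (l : L) (x : X → ℝ) : Prop :=
  match G.node l with
  | .branch φ l₁ l₂ => (l₁ ≠ none ∧ φ.Sat x) ∨ (l₂ ≠ none ∧ ¬ φ.Sat x)
  | _ => True

/-- `η` is a polynomial ranking supermartingale map of degree `d` with constants `ε` and `K`. -/
structure CFG.IsPRSM {L X R : Type*} [Fintype R] (G : CFG L X R) (S : Sampling R)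
    (I : LabelBot L → Pred X) (d : ℕ) (η : LabelBot L → (X → ℝ) → ℝ) (ε K : ℝ) : Prop where
  eps_pos : 0 < ε
  K_le : K ≤ -ε
  poly : ∀ l, ∃ p : MvPolynomial X ℝ, p.totalDegree ≤ d ∧ ∀ x, η l x = MvPolynomial.eval x p
  nonneg : ∀ (l : L) x, (I (some l)).Sat x → 0 ≤ η (some l) x
  terminal : ∀ x, η none x = K
  decrease : ∀ (l : L) x, (I (some l)).Sat x → G.Term l x →
    G.preExp S η (some l) x ≤ η (some l) x - ε

end PP

end

noncomputable section

namespace PP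

open MeasureTheory ProbabilityTheory
open scoped ENNReal

/-! ### Foster-type bound for trajectories of history-dependent kernels -/

section Trajectory

variable {α : Type*} [MeasurableSpace α]

/-! Normalise the supermartingale to `g = (η - K) / ε`. On reachable configurations `g` is
nonnegative: the invariant gives `0 ≤ η` at proper labels, and `η = K` at `⊥`. From a reachable
nonterminal configuration, the expectation of `g` drops by at least 1 in one step, whatever the
scheduler chooses (`nonterminal_add_lintegral_stepLaw_le`). Thus `g` pays one unit for every step
taken before termination, and induction on the horizon bounds the expected number of nonterminal
times among the first `N` by `g` at the start (`lintegral_traj_sum_le`). Letting `N` tend to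
infinity bounds the expected total number of nonterminal times, which dominates the termination
time. Almost sure termination follows from finiteness of this expectation.

The induction peels off the first step of a trajectory instead of tracking the process forward.
Reachability is then needed only at the current history, so neither measurability of the reachable
set nor the fact that runs almost surely stay in it has to be established. -/

/-- The history `h` of length `n` extended by one more state `c`. -/
def extendHistory (n : ℕ) (h : Finset.Iic n → α) (c : α) : Finset.Iic (n + 1) → α :=
  IicProdIoc (X := fun _ => α) n (n + 1)
    (h, MeasurableEquiv.piSingleton (X := fun _ => α) n c)

theorem extendHistory_last (n : ℕ) (h : Finset.Iic n → α) (c : α) :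
    extendHistory n h c ⟨n + 1, Finset.mem_Iic.2 le_rfl⟩ = c := by
  simp [extendHistory, IicProdIoc, MeasurableEquiv.piSingleton]

theorem measurable_extendHistory (n : ℕ) (h : Finset.Iic n → α) :
    Measurable (extendHistory n h) :=
  measurable_IicProdIoc.comp
    (measurable_const.prodMk (MeasurableEquiv.piSingleton (X := fun _ => α) n).measurable)

variable (κ : (n : ℕ) → Kernel (Finset.Iic n → α) α) [∀ n, IsMarkovKernel (κ n)]

/-- First-step decomposition of an integral over trajectories. -/
theorem lintegral_traj_eq_lintegral_step (n : ℕ) (h : Finset.Iic n → α) {f : (ℕ → α) → ℝ≥0∞}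
    (hf : Measurable f) :
    ∫⁻ ω, f ω ∂(Kernel.traj (X := fun _ => α) κ n h) =
      ∫⁻ c, ∫⁻ ω, f ω ∂(Kernel.traj (X := fun _ => α) κ (n + 1) (extendHistory n h c))
        ∂(κ n h) := by
  have hm : Measurable fun h' : Finset.Iic (n + 1) → α =>
      ∫⁻ ω, f ω ∂(Kernel.traj (X := fun _ => α) κ (n + 1) h') := hf.lintegral_kernel
  have hg : Measurable (IicProdIoc (X := fun _ => α) n (n + 1)) := measurable_IicProdIoc
  have hmg : Measurable fun p : (Finset.Iic n → α) × (Finset.Ioc n (n + 1) → α) =>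
      ∫⁻ ω, f ω ∂(Kernel.traj (X := fun _ => α) κ (n + 1)
        (IicProdIoc (X := fun _ => α) n (n + 1) p)) := hm.comp hg
  have hs := (MeasurableEquiv.piSingleton (X := fun _ => α) n).measurable
  -- The one-step partial trajectory is the image under `IicProdIoc` of the product of the Dirac
  -- mass at `h` and the law `κ n h` of the next state. Tonelli's theorem applies, and the Dirac
  -- factor collapses.
  rw [← Kernel.traj_comp_partialTraj (X := fun _ => α) (κ := κ) (Nat.le_add_right n 1),
    Kernel.lintegral_comp _ _ _ hf, Kernel.partialTraj_succ_self,
    Kernel.lintegral_map _ hg _ hm, Kernel.prod_apply, Kernel.id_apply,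
    lintegral_prod _ hmg.aemeasurable,
    lintegral_dirac' _ hmg.lintegral_prod_right']
  exact Kernel.lintegral_map _ hs _ (hmg.comp measurable_prodMk_left)

/-- A trajectory started from `h` keeps the coordinates up to time `n` fixed: their joint law is the
Dirac mass at `h`. -/
theorem lintegral_traj_eval_self (n : ℕ) (h : Finset.Iic n → α) {f : α → ℝ≥0∞}
    (hf : Measurable f) :
    ∫⁻ ω, f (ω n) ∂(Kernel.traj (X := fun _ => α) κ n h) =
      f (h ⟨n, Finset.mem_Iic.2 le_rfl⟩) := by
  have hm : Measurable fun h' : Finset.Iic n → α => f (h' ⟨n, Finset.mem_Iic.2 le_rfl⟩) :=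
    hf.comp (measurable_pi_apply _)
  have := Kernel.traj_map_frestrictLe_apply (X := fun _ => α) (κ := κ) n n h
  rw [Kernel.partialTraj_self, Kernel.id_apply] at this
  rw [← lintegral_dirac' h hm, ← this, lintegral_map hm (by fun_prop)]
  rfl

/-- If `g` dominates the immediate cost `u` plus the expected `g` after one step, along good
states, then the expected cost accumulated over any finite horizon is at most `g`. The set of good
states need not be measurable. -/
theorem lintegral_traj_sum_le {good : α → Prop} {u g : α → ℝ≥0∞} (hu : Measurable u)
    (hstep : ∀ (n : ℕ) (h : Finset.Iic n → α), good (h ⟨n, Finset.mem_Iic.2 le_rfl⟩) →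
      ∀ F : α → ℝ≥0∞, Measurable F → (∀ c, good c → F c ≤ g c) →
      u (h ⟨n, Finset.mem_Iic.2 le_rfl⟩) + ∫⁻ c, F c ∂(κ n h) ≤
        g (h ⟨n, Finset.mem_Iic.2 le_rfl⟩))
    (N n : ℕ) (h : Finset.Iic n → α) (hh : good (h ⟨n, Finset.mem_Iic.2 le_rfl⟩)) :
    ∫⁻ ω, ∑ k ∈ Finset.range N, u (ω (n + k)) ∂(Kernel.traj (X := fun _ => α) κ n h) ≤
      g (h ⟨n, Finset.mem_Iic.2 le_rfl⟩) := by
  induction N generalizing n with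
  | zero => simp
  | succ N ih =>
    have hsum : Measurable fun ω : ℕ → α => ∑ k ∈ Finset.range N, u (ω (n + 1 + k)) :=
      Finset.measurable_sum _ fun k _ => hu.comp (measurable_pi_apply _)
    have hsplit (ω : ℕ → α) : ∑ k ∈ Finset.range (N + 1), u (ω (n + k)) =
        u (ω n) + ∑ k ∈ Finset.range N, u (ω (n + 1 + k)) := by
      rw [Finset.sum_range_succ', add_comm, add_zero]
      exact congrArg _ (Finset.sum_congr rfl fun k _ => by rw [add_assoc, add_comm 1 k])
    have hun : Measurable fun ω : ℕ → α => u (ω n) := hu.comp (measurable_pi_apply n)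
    simp_rw [hsplit]
    rw [lintegral_add_left hun, lintegral_traj_eval_self κ n h hu,
      lintegral_traj_eq_lintegral_step κ n h hsum]
    -- Here `F c` is the expected cost over the remaining `N` times once `c` has been appended to
    -- the history. It may depend on all of `h`, hence the quantification over `F` in `hstep`; the
    -- induction hypothesis bounds it by `g` at good `c`.
    refine hstep n h hh _ ?_ fun c hc => ?_
    · exact hsum.lintegral_kernel.comp (measurable_extendHistory n h)
    · have := ih (n + 1) (extendHistory n h c) (by rwa [extendHistory_last])
      rwa [extendHistory_last] at this

end Trajectory

/-! ### Sampling -/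

section Sampling

variable {R : Type*} [Fintype R]

theorem Sampling.ae_joint_mem_supp (S : Sampling R) : ∀ᵐ r ∂S.joint, ∀ i, r i ∈ S.supp i :=
  Filter.eventually_all.2 fun i => Measure.tendsto_eval_ae_ae.eventually (S.ae_mem_supp i)

/-- Samples almost surely lie in the product of the closures of the supports, a compact box on which
a continuous function is bounded. -/
theorem Sampling.integrable_joint_of_continuous (S : Sampling R) {f : (R → ℝ) → ℝ}
    (hf : Continuous f) : Integrable f S.joint := by
  have hK : IsCompact (Set.univ.pi fun i => closure (S.supp i)) :=
    isCompact_univ_pi fun i => (S.supp_bounded i).isCompact_closure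
  obtain ⟨C, hC⟩ := hK.exists_bound_of_continuousOn hf.continuousOn
  exact Integrable.of_bound hf.aestronglyMeasurable C <|
    S.ae_joint_mem_supp.mono fun r hr => hC r fun i _ => subset_closure (hr i)

theorem Update.continuous_apply_right {X R : Type*} (f : Update X R) (x : X → ℝ) :
    Continuous fun r : R → ℝ => f.apply x r := by
  refine continuous_pi fun i => (MvPolynomial.continuous_eval (f i)).comp ?_
  refine continuous_pi fun j => ?_
  cases j with
  | inl a => exact continuous_const
  | inr a => exact continuous_apply a

end Sampling

/-! ### Ranking supermartingales -/

/-- The normalised value of a ranking supermartingale, which bounds the expected remaining number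
of steps. -/
def rankBound {L X : Type*} (η : LabelBot L → (X → ℝ) → ℝ) (ε K : ℝ) (c : Config L X) : ℝ≥0∞ :=
  ENNReal.ofReal ((η c.1 c.2 - K) / ε)

/-- The indicator of the non-terminal configurations. -/
def nonterminal {L X : Type*} (c : Config L X) : ℝ≥0∞ := if c.1 = none then 0 else 1

theorem measurable_nonterminal {L X : Type*} : Measurable (nonterminal : Config L X → ℝ≥0∞) :=
  (Measurable.of_discrete (f := fun l : LabelBot L => if l = none then (0 : ℝ≥0∞) else 1)).comp
    measurable_fst

theorem measurable_nonterminal_eval {L X : Type*} (k : ℕ) :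
    Measurable fun ω : ℕ → Config L X => nonterminal (ω k) :=
  measurable_nonterminal.comp (measurable_pi_apply k)

/-- Every time before the first visit to `⊥` contributes 1. Only an inequality holds for an
arbitrary sequence, which may leave `⊥` again. -/
theorem terminationTime_le_tsum_nonterminal {L X : Type*} (ω : ℕ → Config L X) :
    terminationTime ω ≤ ∑' k, nonterminal (ω k) := by
  classical
  by_cases h : ∃ n, (ω n).1 = none
  · calc terminationTime ω ≤ (Nat.find h : ℝ≥0∞) := iInf₂_le (Nat.find h) (Nat.find_spec h)
      _ = ∑ k ∈ Finset.range (Nat.find h), nonterminal (ω k) := by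
        have hone : ∀ k ∈ Finset.range (Nat.find h), nonterminal (ω k) = 1 :=
          fun k hk => if_neg (Nat.find_min h (Finset.mem_range.1 hk))
        simp [Finset.sum_congr rfl hone]
      _ ≤ _ := ENNReal.sum_le_tsum _
  · push Not at h
    have : (fun k => nonterminal (ω k)) = fun _ => 1 := funext fun k => if_neg (h k)
    simp [this]

section PRSM

variable {L X R : Type*} [Fintype R] {G : CFG L X R} {S : Sampling R}
  {I : LabelBot L → Pred X} {d : ℕ} {η : LabelBot L → (X → ℝ) → ℝ} {ε K : ℝ} {c₀ : Config L X}

/-- Ensures that `ENNReal.ofReal` truncates nothing in `rankBound` at reachable configurations. -/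
theorem CFG.IsPRSM.K_le_of_reachable (hη : G.IsPRSM S I d η ε K) (hI : G.IsInvariant S c₀ I)
    {c : Config L X} (hc : G.Reachable S c₀ c) : K ≤ η c.1 c.2 := by
  obtain ⟨_ | l, x⟩ := c
  · exact (hη.terminal x).ge
  · have h1 := hη.nonneg l x (hI _ _ hc)
    have h2 := hη.K_le
    have h3 := hη.eps_pos
    dsimp only
    linarith

theorem CFG.IsPRSM.continuous (hη : G.IsPRSM S I d η ε K) (l : LabelBot L) :
    Continuous (η l) := by
  obtain ⟨p, -, hp⟩ := hη.poly l
  rw [funext hp]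
  exact MvPolynomial.continuous_eval p

/-- A real decrease by `ε` of the ranking supermartingale is a decrease by one of its normalised
value. -/
theorem CFG.IsPRSM.one_add_ofReal_le (hη : G.IsPRSM S I d η ε K) {a b : ℝ} (ha : K ≤ a)
    (hab : a ≤ b - ε) : 1 + ENNReal.ofReal ((a - K) / ε) ≤ ENNReal.ofReal ((b - K) / ε) := by
  have hε := hη.eps_pos
  -- Without `K ≤ a` the left-hand value would be truncated at 0, and the drop could be less than 1.
  rw [← ENNReal.ofReal_one,
    ← ENNReal.ofReal_add zero_le_one (div_nonneg (sub_nonneg.2 ha) hε.le)]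
  refine ENNReal.ofReal_le_ofReal ?_
  rw [← div_self hε.ne', ← add_div]
  gcongr
  linarith

/-- The normalised ranking supermartingale decreases by at least one in expectation along each step
from a reachable non-terminal configuration. -/
theorem CFG.IsPRSM.nonterminal_add_lintegral_stepLaw_le [Finite X] (hη : G.IsPRSM S I d η ε K)
    (hI : G.IsInvariant S c₀ I) (b : Bool) {c : Config L X} (hc : G.Reachable S c₀ c)
    {F : Config L X → ℝ≥0∞} (hF : Measurable F)
    (hFle : ∀ c', G.Reachable S c₀ c' → F c' ≤ rankBound η ε K c') :
    nonterminal c + ∫⁻ c', F c' ∂(G.stepLaw S b c) ≤ rankBound η ε K c := by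
  have hε := hη.eps_pos
  obtain ⟨_ | l, x⟩ := c
  -- At `⊥` the cost is 0 and the configuration does not move.
  · simpa [CFG.stepLaw, lintegral_dirac' _ hF, nonterminal] using hFle _ hc
  have hsat := hI _ _ hc
  have hdec := hη.decrease l x hsat
  have hreach (c' : Config L X) (h : G.Step S (some l, x) c') : G.Reachable S c₀ c' :=
    Relation.ReflTransGen.tail hc h
  have hK (c' : Config L X) (h : G.Step S (some l, x) c') : K ≤ η c'.1 c'.2 :=
    hη.K_le_of_reachable hI (hreach c' h)
  rw [show nonterminal ((some l, x) : Config L X) = 1 from if_neg (Option.some_ne_none l)]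
  simp only [CFG.Step] at hreach hK
  simp only [CFG.preExp, CFG.Term] at hdec
  simp only [CFG.stepLaw]
  cases hn : G.node l with
  | assign f l' =>
    simp only [hn, true_implies] at hdec hreach hK ⊢
    rw [lintegral_map hF (measurable_const.prodMk (f.measurable_apply_right x))]
    have hint : Integrable (fun r => η l' (f.apply x r)) S.joint :=
      S.integrable_joint_of_continuous ((hη.continuous l').comp (f.continuous_apply_right x))
    -- Successors are known to be reachable only for samples in the supports, hence the
    -- almost-everywhere bounds. The lower bound `K` also lets the Lebesgue integral be rewritten as
    -- a Bochner integral.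
    have hKae : ∀ᵐ r ∂S.joint, K ≤ η l' (f.apply x r) :=
      S.ae_joint_mem_supp.mono fun r hr => hK _ ⟨r, hr, rfl⟩
    have hle : ∫⁻ r, F (l', f.apply x r) ∂S.joint ≤
        ENNReal.ofReal ((∫ r, η l' (f.apply x r) ∂S.joint - K) / ε) := by
      calc ∫⁻ r, F (l', f.apply x r) ∂S.joint
          ≤ ∫⁻ r, ENNReal.ofReal ((η l' (f.apply x r) - K) / ε) ∂S.joint :=
            lintegral_mono_ae <| S.ae_joint_mem_supp.mono fun r hr =>
              hFle _ (hreach _ ⟨r, hr, rfl⟩)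
        _ = ENNReal.ofReal (∫ r, (η l' (f.apply x r) - K) / ε ∂S.joint) := by
            refine (ofReal_integral_eq_lintegral_ofReal
              ((hint.sub (integrable_const K)).div_const ε) ?_).symm
            exact hKae.mono fun r hr => div_nonneg (sub_nonneg.2 hr) hε.le
        _ = _ := by
            rw [integral_div, integral_sub hint (integrable_const K)]
            simp
    have hKint : K ≤ ∫ r, η l' (f.apply x r) ∂S.joint := by
      simpa using integral_mono_ae (integrable_const K) hint hKae
    exact (add_le_add_right hle 1).trans (hη.one_add_ofReal_le hKint hdec)
  | prob p l₁ l₂ =>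
    simp only [hn, true_implies] at hdec hreach hK ⊢
    have hp0 : (0 : ℝ) ≤ p := p.2.1.le
    have hp1 : (0 : ℝ) ≤ 1 - p := sub_nonneg.2 p.2.2.le
    have hK1 : K ≤ η l₁ x := hK _ (Or.inl rfl)
    have hK2 : K ≤ η l₂ x := hK _ (Or.inr rfl)
    rw [lintegral_add_measure, lintegral_smul_measure, lintegral_smul_measure,
      lintegral_dirac' _ hF, lintegral_dirac' _ hF]
    have hle : ENNReal.ofReal p • F (l₁, x) + ENNReal.ofReal (1 - p) • F (l₂, x) ≤
        ENNReal.ofReal ((p * η l₁ x + (1 - p) * η l₂ x - K) / ε) := by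
      calc _ ≤ ENNReal.ofReal p * ENNReal.ofReal ((η l₁ x - K) / ε) +
            ENNReal.ofReal (1 - p) * ENNReal.ofReal ((η l₂ x - K) / ε) :=
            add_le_add (mul_le_mul_right (hFle _ (hreach _ (Or.inl rfl))) _)
              (mul_le_mul_right (hFle _ (hreach _ (Or.inr rfl))) _)
        _ = _ := by
            have h1 := div_nonneg (sub_nonneg.2 hK1) hε.le
            have h2 := div_nonneg (sub_nonneg.2 hK2) hε.le
            rw [← ENNReal.ofReal_mul hp0, ← ENNReal.ofReal_mul hp1,
              ← ENNReal.ofReal_add (mul_nonneg hp0 h1) (mul_nonneg hp1 h2)]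
            congr 1
            ring
    refine (add_le_add_right hle 1).trans (hη.one_add_ofReal_le ?_ hdec)
    linarith [mul_le_mul_of_nonneg_left hK1 hp0, mul_le_mul_of_nonneg_left hK2 hp1]
  | branch φ l₁ l₂ =>
    simp only [hn] at hdec hreach hK ⊢
    have key (l' : LabelBot L) (hr : G.Reachable S c₀ (l', x))
        (hd : l' ≠ none → η l' x ≤ η (some l) x - ε) :
        1 + ∫⁻ c', F c' ∂(Measure.dirac ((l', x) : Config L X)) ≤
          rankBound η ε K (some l, x) := by
      rw [lintegral_dirac' _ hF]
      refine (add_le_add_right (hFle _ hr) 1).trans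
        (hη.one_add_ofReal_le (hη.K_le_of_reachable hI hr) ?_)
      cases l' with
      -- No decrease is assumed for a branch that exits to `⊥`; it follows from `K ≤ -ε` and `0 ≤ η`
      -- at the current label.
      | none =>
        have h1 := hη.nonneg l x hsat
        have h2 := hη.K_le
        rw [hη.terminal]
        linarith
      | some l' => exact hd (Option.some_ne_none l')
    by_cases hφ : φ.Sat x
    · simp only [hφ, if_true] at hdec ⊢
      exact key l₁ (hreach _ (Or.inl ⟨hφ, rfl⟩)) fun h => hdec (Or.inl ⟨h, trivial⟩)
    · simp only [hφ, if_false] at hdec ⊢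
      exact key l₂ (hreach _ (Or.inr ⟨hφ, rfl⟩)) fun h => hdec (Or.inr ⟨h, not_false⟩)
  | demonic l₁ l₂ =>
    simp only [hn, true_implies] at hdec hreach hK ⊢
    rw [lintegral_dirac' _ hF]
    -- Either choice of the scheduler is bounded by the maximum in the pre-expectation.
    cases b
    · exact (add_le_add_right (hFle _ (hreach _ (Or.inr rfl))) 1).trans
        (hη.one_add_ofReal_le (hK _ (Or.inr rfl)) ((le_max_right _ _).trans hdec))
    · exact (add_le_add_right (hFle _ (hreach _ (Or.inl rfl))) 1).trans
        (hη.one_add_ofReal_le (hK _ (Or.inl rfl)) ((le_max_left _ _).trans hdec))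

/-! ### Expected termination time and almost sure termination -/

theorem CFG.IsPRSM.lintegral_tsum_nonterminal_le [Finite L] [Finite X] (hη : G.IsPRSM S I d η ε K)
    (hI : G.IsInvariant S c₀ I) (σ : Scheduler L X) :
    ∫⁻ ω, ∑' k, nonterminal (ω k) ∂(G.runMeasure S c₀ σ) ≤ rankBound η ε K c₀ := by
  rw [lintegral_tsum fun k => (measurable_nonterminal_eval k).aemeasurable]
  refine ENNReal.tsum_le_of_sum_range_le fun N => ?_
  rw [← lintegral_finsetSum _ fun k _ => measurable_nonterminal_eval k]
  have := lintegral_traj_sum_le (G.stepKernel S σ) (good := G.Reachable S c₀)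
    (g := rankBound η ε K) measurable_nonterminal
    (fun n h hh F hF hFle => hη.nonterminal_add_lintegral_stepLaw_le hI _ hh hF hFle)
    N 0 (fun _ => c₀) Relation.ReflTransGen.refl
  simpa only [zero_add] using! this

theorem CFG.IsPRSM.lintegral_terminationTime_le [Finite L] [Finite X] (hη : G.IsPRSM S I d η ε K)
    (hI : G.IsInvariant S c₀ I) (σ : Scheduler L X) :
    ∫⁻ ω, terminationTime ω ∂(G.runMeasure S c₀ σ) ≤ rankBound η ε K c₀ :=
  (lintegral_mono terminationTime_le_tsum_nonterminal).trans
    (hη.lintegral_tsum_nonterminal_le hI σ)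

theorem CFG.IsPRSM.ae_terminationTime_lt_top [Finite L] [Finite X] (hη : G.IsPRSM S I d η ε K)
    (hI : G.IsInvariant S c₀ I) (σ : Scheduler L X) :
    ∀ᵐ ω ∂(G.runMeasure S c₀ σ), terminationTime ω < ∞ := by
  -- Finiteness is derived for the sum of indicators, whose measurability is immediate, and passes
  -- to the termination time by domination.
  have hm : Measurable fun ω : ℕ → Config L X => ∑' k, nonterminal (ω k) :=
    Measurable.tsum fun k => measurable_nonterminal_eval k
  filter_upwards [ae_lt_top hm
    ((hη.lintegral_tsum_nonterminal_le hI σ).trans_lt ENNReal.ofReal_lt_top).ne] with ω hω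
  exact (terminationTime_le_tsum_nonterminal ω).trans_lt hω

end PRSM

instance CFG.instIsProbRunMeasure {L X R : Type*} [Finite L] [Finite X] [Fintype R]
    (G : CFG L X R) (S : Sampling R) (c₀ : Config L X) (σ : Scheduler L X) :
    IsProbabilityMeasure (G.runMeasure S c₀ σ) := by
  unfold CFG.runMeasure; infer_instance

end PP

end

theorem theorem1 {X R : Type*} [Fintype X] [Fintype R] (P : PP.Program X R) (S : PP.Sampling R)
    (x₀ : X → ℝ) (I : PP.LabelBot P.Label → PP.Pred X)
    (hI : P.cfg.IsInvariant S (some P.entry, x₀) I)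
    (d : ℕ) (η : PP.LabelBot P.Label → (X → ℝ) → ℝ) (ε K : ℝ)
    (hη : P.cfg.IsPRSM S I d η ε K) :
    P.cfg.ASTerminating S (some P.entry, x₀) ∧
      P.cfg.ET S (some P.entry, x₀) ≤ ENNReal.ofReal ((η (some P.entry) x₀ - K) / ε) := by
  refine ⟨fun σ => ?_, iSup_le fun σ => hη.lintegral_terminationTime_le hI σ⟩
  rw [MeasureTheory.measure_congr
    (Filter.eventuallyEq_univ.2 (hη.ae_terminationTime_lt_top hI σ)), MeasureTheory.measure_univ]
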